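/- Let $\mathbb{D}=\{z\in\mathbb{C}:|z|<1\}$ and let $H(\mathbb{D})$ be the space of holomorphic functions on $\mathbb{D}$, equipped with the topology of uniform convergence on the compact subsets of $\mathbb{D}$. For $t\in[0,1)$ let $C_t\colon H(\mathbb{D})\to H(\mathbb{D})$ be the continuous linear operator given by $C_tf(0):=f(0)$ and $$C_tf(z):=\frac1z\int_0^z\frac{f(\xi)}{1-t\xi}\,d\xi,\qquad z\in\mathbb{D}\setminus\{0\}.$$ Proposition. For each $t\in[0,1)$ the operator $C_t$ is power bounded (that is, $\{C_t^n:n\ge 0\}$ is equicontinuous) and uniformly mean ergodic (that is, the averages $\frac1n\sum_{m=1}^nC_t^m$ converge, as $n\to\infty$, in the space of continuous linear operators on $H(\mathbb{D})$ with the topology of uniform convergence on bounded subsets of $H(\mathbb{D})$), but it is not supercyclic (that is, for no $f\in H(\mathbb{D})$ is the set $\{\lambda C_t^nf:\lambda\in\mathbb{C},\ n\ge0\}$ dense in $H(\mathbb{D})$). Moreover, $(I-C_t)(H(\mathbb{D}))$ is the closed subspace of $H(\mathbb{D})$ given by $$(I-C_t)(H(\mathbb{D}))=\{g\in H(\mathbb{D}):g(0)=0\},$$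 and one has the (topological) direct sum decomposition $$H(\mathbb{D})=\operatorname{Ker}(I-C_t)\oplus(I-C_t)(H(\mathbb{D})).$$ -/

import Mathlib

open Topology Filter Set

noncomputable section

/-! ### The space of holomorphic functions on the open unit disc -/

/-- The holomorphic functions on the open unit disc, as a linear subspace of the continuous functions
on the disc. -/
def holSubmodule : Submodule ℂ C(Metric.ball (0 : ℂ) 1, ℂ) where
  carrier := {f | ∃ F : ℂ → ℂ, DifferentiableOn ℂ F (Metric.ball 0 1) ∧
    ∀ z : Metric.ball (0 : ℂ) 1, f z = F z}
  add_mem' := by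
    rintro f g ⟨F, hF, hf⟩ ⟨G, hG, hg⟩
    exact ⟨F + G, hF.add hG, fun z => by simp [hf, hg]⟩
  zero_mem' := ⟨0, differentiableOn_const 0, fun z => rfl⟩
  smul_mem' := by
    rintro c f ⟨F, hF, hf⟩
    exact ⟨c • F, hF.const_smul c, fun z => by simp [hf]⟩

/-- The space `H(𝔻)` of holomorphic functions on the open unit disc, with the topology (and the
uniform structure) induced by the compact-open topology on the continuous functions, that is, the
topology of uniform convergence on the compact subsets of the disc. -/
def HolDisc : Type := holSubmodule

namespace HolDisc

instance : AddCommGroup HolDisc := inferInstanceAs (AddCommGroup holSubmodule)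

instance : Module ℂ HolDisc := inferInstanceAs (Module ℂ holSubmodule)

instance : UniformSpace HolDisc := inferInstanceAs (UniformSpace holSubmodule)

instance : ContinuousSMul ℂ HolDisc := inferInstanceAs (ContinuousSMul ℂ holSubmodule)

/-- A holomorphic function on the disc, as a continuous function on the disc. -/
def toMap (f : HolDisc) : C(Metric.ball (0 : ℂ) 1, ℂ) := Subtype.val f

instance : CoeFun HolDisc fun _ => Metric.ball (0 : ℂ) 1 → ℂ := ⟨fun f => f.toMap⟩

theorem isInducing_toMap : IsInducing toMap := IsInducing.subtypeVal

theorem ext' {f g : HolDisc} (h : ∀ z, f z = g z) : f = g :=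
  Subtype.ext (ContinuousMap.ext h)

theorem add_apply (f g : HolDisc) (z : Metric.ball (0 : ℂ) 1) : (f + g) z = f z + g z := rfl

theorem smul_apply (c : ℂ) (f : HolDisc) (z : Metric.ball (0 : ℂ) 1) : (c • f) z = c * f z := rfl

/-- The uniform structure of compact convergence is compatible with addition. -/
instance : IsUniformAddGroup HolDisc := by
  let φ : C(Metric.ball (0 : ℂ) 1, ℂ) →+
      UniformOnFun (Metric.ball (0 : ℂ) 1) ℂ {K | IsCompact K} :=
    { toFun := ContinuousMap.toUniformOnFunIsCompact
      map_zero' := rfl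
      map_add' := fun _ _ => rfl }
  have : IsUniformAddGroup C(Metric.ball (0 : ℂ) 1, ℂ) :=
    (ContinuousMap.isUniformEmbedding_toUniformOnFunIsCompact.isUniformInducing).isUniformAddGroup φ
  exact inferInstanceAs (IsUniformAddGroup holSubmodule.toAddSubgroup)

/-- The centre of the disc. -/
def center : Metric.ball (0 : ℂ) 1 := ⟨0, Metric.mem_ball_self one_pos⟩

open Classical in
/-- The value at a point `z` of the open unit disc of `f ∈ H(𝔻)`, with the value `0` assigned to the
points outside the disc. -/
def extendZero (f : HolDisc) (z : ℂ) : ℂ :=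
  if hz : z ∈ Metric.ball (0 : ℂ) 1 then f ⟨z, hz⟩ else 0

theorem extendZero_of_mem (f : HolDisc) {z : ℂ} (hz : z ∈ Metric.ball (0 : ℂ) 1) :
    f.extendZero z = f ⟨z, hz⟩ := dif_pos hz

theorem differentiableOn_extendZero (f : HolDisc) :
    DifferentiableOn ℂ f.extendZero (Metric.ball 0 1) := by
  obtain ⟨F, hF, hf⟩ := f.2
  refine hF.congr fun z hz => ?_
  rw [extendZero_of_mem f hz]
  exact hf ⟨z, hz⟩

end HolDisc

/-! ### The generalized Cesàro operators -/

/-- The complex line integral `∫₀ᶻ g(ξ) dξ` along the segment `s ↦ s z`, `0 ≤ s ≤ 1`. -/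
def segmentIntegral (g : ℂ → ℂ) (z : ℂ) : ℂ :=
  ∫ s in (0 : ℝ)..1, g (s * z) * z

/-- The function `C_t f`: its value at `0` is `f(0)`, and its value at a point `z ≠ 0` of the disc is
`(1/z) ∫₀ᶻ f(ξ) / (1 - t ξ) dξ`. -/
def cesaroFun (t : ℝ) (f : HolDisc) (z : ℂ) : ℂ :=
  if z = 0 then f.extendZero 0
  else (1 / z) * segmentIntegral (fun ξ => f.extendZero ξ / (1 - t * ξ)) z

namespace HolDisc

theorem mul_mem_ball {s : ℝ} (hs : s ∈ Icc (0 : ℝ) 1) {z : ℂ} (hz : z ∈ Metric.ball (0 : ℂ) 1) :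
    (s : ℂ) * z ∈ Metric.ball (0 : ℂ) 1 := by
  rw [mem_ball_zero_iff] at hz ⊢
  rw [norm_mul, Complex.norm_real, Real.norm_of_nonneg hs.1]
  exact lt_of_le_of_lt (mul_le_of_le_one_left (norm_nonneg z) hs.2) hz

theorem one_sub_ne_zero {t : ℝ} (ht : t ∈ Ico (0 : ℝ) 1) {z : ℂ}
    (hz : z ∈ Metric.ball (0 : ℂ) 1) : 1 - (t : ℂ) * z ≠ 0 := by
  have h := mul_mem_ball ⟨ht.1, ht.2.le⟩ hz
  rw [mem_ball_zero_iff] at h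
  intro h0
  rw [← sub_eq_zero.mp h0] at h
  simp at h

theorem differentiableOn_integrand {t : ℝ} (ht : t ∈ Ico (0 : ℝ) 1) (f : HolDisc) :
    DifferentiableOn ℂ (fun ξ => f.extendZero ξ / (1 - t * ξ)) (Metric.ball 0 1) :=
  f.differentiableOn_extendZero.div (by fun_prop) fun _ hz => one_sub_ne_zero ht hz

/-- An integral formula for `C_t f` valid on the whole disc. -/
theorem cesaroFun_eq (t : ℝ) (f : HolDisc) (z : ℂ) :
    cesaroFun t f z = ∫ s in (0 : ℝ)..1, f.extendZero (s * z) / (1 - t * (s * z)) := by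
  unfold cesaroFun segmentIntegral
  split_ifs with h
  · simp [h]
  · rw [intervalIntegral.integral_mul_const, mul_comm, mul_assoc, mul_one_div_cancel h, mul_one]

theorem differentiableOn_cesaroFun {t : ℝ} (ht : t ∈ Ico (0 : ℝ) 1) (f : HolDisc) :
    DifferentiableOn ℂ (cesaroFun t f) (Metric.ball 0 1) := by
  obtain ⟨H, hH⟩ := (differentiableOn_integrand ht f).isExactOn_ball
  have hball : Metric.ball (0 : ℂ) 1 ∈ 𝓝 (0 : ℂ) := Metric.ball_mem_nhds _ one_pos
  have hHd : DifferentiableOn ℂ H (Metric.ball 0 1) := fun z hz =>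
    (hH z hz).differentiableAt.differentiableWithinAt
  refine ((Complex.differentiableOn_dslope hball).2 hHd).congr fun z hz => ?_
  by_cases h : z = 0
  · subst h
    rw [dslope_same, (hH 0 hz).deriv]
    simp [cesaroFun]
  · rw [dslope_of_ne _ h, slope_def_field, cesaroFun, if_neg h]
    have key : segmentIntegral (fun ξ => f.extendZero ξ / (1 - t * ξ)) z = H z - H 0 := by
      have hd : ∀ s ∈ uIcc (0 : ℝ) 1, HasDerivAt (fun s : ℝ => H (s * z))
          (f.extendZero (s * z) / (1 - t * (s * z)) * z) s := by
        intro s hs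
        rw [uIcc_of_le zero_le_one] at hs
        have h1 : HasDerivAt (fun s : ℝ => (s : ℂ) * z) z s := by
          simpa using (Complex.ofRealCLM.hasDerivAt (x := s)).mul_const z
        exact (hH _ (mul_mem_ball hs hz)).comp s h1
      have hc : ContinuousOn (fun s : ℝ => f.extendZero (s * z) / (1 - t * (s * z)) * z)
          (uIcc (0 : ℝ) 1) := by
        rw [uIcc_of_le zero_le_one]
        have := (differentiableOn_integrand ht f).continuousOn.comp
          (f := fun s : ℝ => (s : ℂ) * z) (s := Icc (0 : ℝ) 1) (by fun_prop)
          fun s hs => mul_mem_ball hs hz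
        exact this.mul continuousOn_const
      have := intervalIntegral.integral_eq_sub_of_hasDerivAt hd hc.intervalIntegrable
      simpa [segmentIntegral] using this
    rw [key, sub_zero, one_div, div_eq_inv_mul]

/-- The point `s z` of the disc, for `0 ≤ s ≤ 1` and `z` in the disc (with `s` clamped to
`[0, 1]`). -/
def ray (s : ℝ) (z : Metric.ball (0 : ℂ) 1) : Metric.ball (0 : ℂ) 1 :=
  ⟨((projIcc (0 : ℝ) 1 zero_le_one s : ℝ) : ℂ) * z, mul_mem_ball (Subtype.prop _) z.2⟩

theorem continuous_ray : Continuous fun p : Metric.ball (0 : ℂ) 1 × ℝ => ray p.2 p.1 := by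
  unfold ray
  refine Continuous.subtype_mk ?_ _
  have : Continuous fun p : Metric.ball (0 : ℂ) 1 × ℝ => projIcc (0 : ℝ) 1 zero_le_one p.2 :=
    continuous_projIcc.comp continuous_snd
  fun_prop

theorem cesaroFun_eq_ray (t : ℝ) (f : HolDisc) (z : Metric.ball (0 : ℂ) 1) :
    cesaroFun t f z = ∫ s in (0 : ℝ)..1, f (ray s z) / (1 - t * (ray s z : ℂ)) := by
  rw [cesaroFun_eq]
  refine intervalIntegral.integral_congr fun s hs => ?_
  rw [uIcc_of_le zero_le_one] at hs
  have : (ray s z : ℂ) = s * z := by simp [ray, projIcc_of_mem zero_le_one hs]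
  simp only [← this]
  rw [extendZero_of_mem f (ray s z).2]

theorem continuous_cesaroFun {t : ℝ} (ht : t ∈ Ico (0 : ℝ) 1) :
    Continuous fun p : HolDisc × Metric.ball (0 : ℂ) 1 => cesaroFun t p.1 p.2 := by
  have : LocallyCompactSpace (Metric.ball (0 : ℂ) 1) := Metric.isOpen_ball.locallyCompactSpace
  simp only [cesaroFun_eq_ray]
  refine intervalIntegral.continuous_parametric_intervalIntegral_of_continuous'
    (f := fun (p : HolDisc × Metric.ball (0 : ℂ) 1) (s : ℝ) =>
      p.1 (ray s p.2) / (1 - t * (ray s p.2 : ℂ))) ?_ 0 1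
  have hr : Continuous fun q : (HolDisc × Metric.ball (0 : ℂ) 1) × ℝ => ray q.2 q.1.2 :=
    continuous_ray.comp (f := fun q : (HolDisc × Metric.ball (0 : ℂ) 1) × ℝ => (q.1.2, q.2))
      (by fun_prop)
  have hf : Continuous fun q : (HolDisc × Metric.ball (0 : ℂ) 1) × ℝ => q.1.1.toMap :=
    isInducing_toMap.continuous.comp (continuous_fst.comp continuous_fst)
  have hn : Continuous fun q : (HolDisc × Metric.ball (0 : ℂ) 1) × ℝ =>
      q.1.1 (ray q.2 q.1.2) := hf.eval hr
  have hd : Continuous fun q : (HolDisc × Metric.ball (0 : ℂ) 1) × ℝ =>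
      1 - (t : ℂ) * (ray q.2 q.1.2 : ℂ) := by fun_prop
  exact hn.div hd fun q => one_sub_ne_zero ht (ray q.2 q.1.2).2

theorem intervalIntegrable_ray {t : ℝ} (ht : t ∈ Ico (0 : ℝ) 1) (f : HolDisc)
    (z : Metric.ball (0 : ℂ) 1) :
    IntervalIntegrable (fun s : ℝ => f (ray s z) / (1 - t * (ray s z : ℂ)))
      MeasureTheory.volume 0 1 := by
  have hr : Continuous fun s : ℝ => ray s z :=
    continuous_ray.comp (f := fun s : ℝ => (z, s)) (by fun_prop)
  have hd : Continuous fun s : ℝ => 1 - (t : ℂ) * (ray s z : ℂ) := by fun_prop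
  exact ((f.toMap.continuous.comp hr).div hd
    fun s => one_sub_ne_zero ht (ray s z).2).intervalIntegrable 0 1

end HolDisc

/-- The generalized Cesàro operator `C_t : H(𝔻) → H(𝔻)`, `0 ≤ t < 1`, as a continuous linear
operator. -/
def cesaroOp (t : Ico (0 : ℝ) 1) : HolDisc →L[ℂ] HolDisc where
  toFun f := ⟨⟨fun z => cesaroFun t f z,
      (HolDisc.continuous_cesaroFun t.2).comp (Continuous.prodMk_right f)⟩,
    cesaroFun t f, HolDisc.differentiableOn_cesaroFun t.2 f, fun _ => rfl⟩
  map_add' f g := by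
    refine HolDisc.ext' fun z => ?_
    change cesaroFun t (f + g) z = cesaroFun t f z + cesaroFun t g z
    simp only [HolDisc.cesaroFun_eq_ray]
    rw [← intervalIntegral.integral_add (HolDisc.intervalIntegrable_ray t.2 f z)
      (HolDisc.intervalIntegrable_ray t.2 g z)]
    refine intervalIntegral.integral_congr fun s _ => ?_
    simp [HolDisc.add_apply, add_div]
  map_smul' c f := by
    refine HolDisc.ext' fun z => ?_
    change cesaroFun t (c • f) z = c * cesaroFun t f z
    simp only [HolDisc.cesaroFun_eq_ray]
    rw [← intervalIntegral.integral_const_mul]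
    refine intervalIntegral.integral_congr fun s _ => ?_
    simp [HolDisc.smul_apply, mul_div_assoc]
  cont := by
    refine HolDisc.isInducing_toMap.continuous_iff.2 ?_
    exact ContinuousMap.continuous_of_continuous_uncurry _ (HolDisc.continuous_cesaroFun t.2)

/-! ### Linear dynamics and mean ergodicity -/

/-- `T` is power bounded: the set of its iterates `Tⁿ`, `n ≥ 0`, is equicontinuous. -/
def IsPowerBoundedOp {X : Type*} [AddCommGroup X] [Module ℂ X] [UniformSpace X]
    [IsUniformAddGroup X] (T : X →L[ℂ] X) : Prop :=
  Equicontinuous fun n : ℕ => (⇑(T ^ n) : X → X)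

/-- The Cesàro means `T_[n] = (1/n) ∑_{m=1}^n T^m` of `T`, for `n ≥ 1`. -/
def cesaroMean {X : Type*} [AddCommGroup X] [Module ℂ X] [TopologicalSpace X]
    [IsTopologicalAddGroup X] [ContinuousConstSMul ℂ X] (T : X →L[ℂ] X) (n : ℕ) : X →L[ℂ] X :=
  (n : ℂ)⁻¹ • ∑ m ∈ Finset.Icc 1 n, T ^ m

/-- `T` is uniformly mean ergodic: its Cesàro means converge in the space of continuous linear
operators, equipped with the topology of uniform convergence on bounded sets (this is the topology
that Mathlib puts on `X →L[ℂ] X`). -/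
def IsUniformlyMeanErgodic {X : Type*} [AddCommGroup X] [Module ℂ X] [TopologicalSpace X]
    [IsTopologicalAddGroup X] [ContinuousConstSMul ℂ X] (T : X →L[ℂ] X) : Prop :=
  ∃ P : X →L[ℂ] X, Tendsto (cesaroMean T) atTop (𝓝 P)

/-- `T` is supercyclic: some vector has a dense projective orbit. -/
def IsSupercyclicOp {X : Type*} [AddCommGroup X] [Module ℂ X] [TopologicalSpace X]
    (T : X →L[ℂ] X) : Prop :=
  ∃ x : X, Dense {y : X | ∃ (c : ℂ) (n : ℕ), y = c • (T ^ n) x}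

end

/-! The functions `z ^ j / (1 - t z) ^ (j + 1)` are eigenfunctions of `C_t` with eigenvalues `1 / (j
+ 1)`. Since `|1 - t ξ| ≥ 1 - t |ξ|`, a bound of `|f(z)|` by a multiple of the `j`-th eigenfunction
at `|z|` survives `C_t` and gains the factor `1 / (j + 1)` (`norm_cesaroOp_le`).

For `j = 0` this bounds all iterates uniformly on each disc, hence power boundedness. For `j = 1`,
combined with the Schwarz lemma, it makes the iterates decay like `2 ^ (-n)` on functions vanishing
at `0`.

As `C_t` preserves `f(0)` and fixes `1 / (1 - t z)`, everything splits along the projection `P f =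
f(0) / (1 - t z)`: `C_t ^ n f - P f` is the `n`-th iterate at `f - P f`, which decays, so the means
tend to `P`. The range of `I - C_t` is found by solving a first-order linear ODE. Supercyclicity
fails because `f(0)` is preserved while the iterates stay bounded. -/

namespace HolDisc

/-! ### Topology of `H(𝔻)`: suprema on discs, evaluations, bounded sets, Schwarz lemma. -/

theorem sub_apply (f g : HolDisc) (z : Metric.ball (0 : ℂ) 1) : (f - g) z = f z - g z := rfl

theorem zero_apply (z : Metric.ball (0 : ℂ) 1) : (0 : HolDisc) z = 0 := rfl

theorem coe_cesaroOp (t : Ico (0 : ℝ) 1) (f : HolDisc) (z : Metric.ball (0 : ℂ) 1) :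
    cesaroOp t f z = cesaroFun t f z := rfl

theorem norm_lt_one (z : Metric.ball (0 : ℂ) 1) : ‖(z : ℂ)‖ < 1 := mem_ball_zero_iff.1 z.2

theorem isCompact_norm_le {r : ℝ} (hr : r < 1) :
    IsCompact {z : Metric.ball (0 : ℂ) 1 | ‖(z : ℂ)‖ ≤ r} := by
  rw [IsInducing.subtypeVal.isCompact_iff]
  convert isCompact_closedBall (0 : ℂ) r using 1
  ext z
  simp only [mem_image, mem_ofPred_eq, mem_closedBall_zero_iff]
  exact ⟨fun ⟨w, hw, h⟩ => h ▸ hw, fun h => ⟨⟨z, by simpa using h.trans_lt hr⟩, h, rfl⟩⟩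

/-- A basis of neighbourhoods of `0` in `H(𝔻)`, given by the suprema on the discs of radius
`r < 1`. -/
theorem hasBasis_nhds_zero :
    (𝓝 (0 : HolDisc)).HasBasis (fun p : ℝ × ℝ => p.1 ∈ Ioo (0 : ℝ) 1 ∧ 0 < p.2)
      fun p => {f | ∀ z : Metric.ball (0 : ℂ) 1, ‖(z : ℂ)‖ ≤ p.1 → ‖f z‖ < p.2} := by
  have h1 := isInducing_toMap.basis_nhds (x := (0 : HolDisc)) (nhds_basis_uniformity'
    (x := toMap 0) (Metric.uniformity_basis_dist (α := ℂ)).compactConvergenceUniformity)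
  refine h1.to_hasBasis ?_ ?_
  · rintro ⟨K, ε⟩ ⟨hK, hε⟩
    obtain ⟨r, hr, hKr⟩ : ∃ r ∈ Ioo (0 : ℝ) 1, ∀ z ∈ K, ‖(z : ℂ)‖ ≤ r := by
      rcases K.eq_empty_or_nonempty with rfl | hne
      · exact ⟨1 / 2, by norm_num, by simp⟩
      · obtain ⟨w, -, hw⟩ := hK.exists_isMaxOn hne
          (f := fun z : Metric.ball (0 : ℂ) 1 => ‖(z : ℂ)‖) (by fun_prop)
        have hw1 := norm_lt_one w
        exact ⟨(‖(w : ℂ)‖ + 1) / 2, ⟨by positivity, by linarith⟩,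
          fun z hz => (hw hz : ‖(z : ℂ)‖ ≤ ‖(w : ℂ)‖).trans (by linarith)⟩
    refine ⟨⟨r, ε⟩, ⟨hr, hε⟩, fun f hf z hz => ?_⟩
    have : dist (0 : ℂ) (f z) < ε := by simpa using hf z (hKr z hz)
    exact this
  · rintro ⟨r, ε⟩ ⟨hr, hε⟩
    refine ⟨⟨_, ε⟩, ⟨isCompact_norm_le hr.2, hε⟩, fun f hf z hz => ?_⟩
    have : dist (0 : ℂ) (f z) < ε := hf z hz
    simpa using this

/-- The evaluation at a point of the disc, as a continuous linear functional. -/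
noncomputable def evalCLM (z : Metric.ball (0 : ℂ) 1) : HolDisc →L[ℂ] ℂ where
  toFun f := f z
  map_add' _ _ := rfl
  map_smul' _ _ := rfl
  cont := (ContinuousEvalConst.continuous_eval_const z).comp isInducing_toMap.continuous

theorem evalCLM_apply (z : Metric.ball (0 : ℂ) 1) (f : HolDisc) : evalCLM z f = f z := rfl

/-- The element of `H(𝔻)` given by a function that is holomorphic on the disc. -/
def ofFun (F : ℂ → ℂ) (hF : DifferentiableOn ℂ F (Metric.ball 0 1)) : HolDisc :=
  ⟨⟨fun z => F z, continuousOn_iff_continuous_domRestrict.1 hF.continuousOn⟩, F, hF, fun _ => rfl⟩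

theorem ofFun_apply (F : ℂ → ℂ) (hF : DifferentiableOn ℂ F (Metric.ball 0 1))
    (z : Metric.ball (0 : ℂ) 1) : ofFun F hF z = F z := rfl

theorem exists_norm_le (f : HolDisc) {r : ℝ} (hr : r < 1) :
    ∃ M, ∀ z : Metric.ball (0 : ℂ) 1, ‖(z : ℂ)‖ ≤ r → ‖f z‖ ≤ M :=
  (isCompact_norm_le hr).exists_bound_of_continuousOn f.toMap.continuous.continuousOn

/-- A bounded set is absorbed by the neighbourhood `{|g| < 1 on |z| ≤ r}`; the absorbing scalar
gives the bound. -/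
theorem exists_norm_le_of_isVonNBounded {S : Set HolDisc} (hS : Bornology.IsVonNBounded ℂ S)
    {r : ℝ} (hr : r ∈ Ioo (0 : ℝ) 1) :
    ∃ M, ∀ f ∈ S, ∀ z : Metric.ball (0 : ℂ) 1, ‖(z : ℂ)‖ ≤ r → ‖f z‖ ≤ M := by
  have hV := hasBasis_nhds_zero.mem_of_mem (i := (r, 1)) ⟨hr, one_pos⟩
  obtain ⟨c, hc⟩ := (hS hV).exists
  refine ⟨‖c‖, fun f hf z hz => ?_⟩
  obtain ⟨g, hg, rfl⟩ := hc hf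
  rw [smul_apply, norm_mul]
  exact mul_le_of_le_one_right (norm_nonneg c) (hg z hz).le

/-- The Schwarz lemma on the disc of radius `r`. -/
theorem norm_le_mul_norm_of_center_eq_zero {f : HolDisc} (hf : f center = 0) {r M : ℝ}
    (hr : r ∈ Ioo (0 : ℝ) 1) (hM : ∀ z : Metric.ball (0 : ℂ) 1, ‖(z : ℂ)‖ ≤ r → ‖f z‖ ≤ M)
    {z : Metric.ball (0 : ℂ) 1} (hz : ‖(z : ℂ)‖ < r) : ‖f z‖ ≤ M / r * ‖(z : ℂ)‖ := by
  have h0 : f.extendZero 0 = 0 := (f.extendZero_of_mem center.2).trans hf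
  have := Complex.dist_le_div_mul_dist_of_mapsTo_ball (f := f.extendZero) (c := 0) (R₁ := r)
    (R₂ := M) (z := z) (f.differentiableOn_extendZero.mono (Metric.ball_subset_ball hr.2.le)) ?_
    (by simpa using hz)
  · rwa [h0, dist_zero_right, dist_zero_right, extendZero_of_mem f z.2] at this
  · intro w hw
    have hw1 : ‖w‖ < r := by simpa using hw
    have hw2 : w ∈ Metric.ball (0 : ℂ) 1 := by simpa using hw1.trans hr.2
    rw [h0, mem_closedBall_zero_iff, extendZero_of_mem f hw2]
    exact hM ⟨w, hw2⟩ hw1.le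

/-! ### Estimates for the iterates -/

theorem norm_ray {s : ℝ} (hs : s ∈ Icc (0 : ℝ) 1) (z : Metric.ball (0 : ℂ) 1) :
    ‖(ray s z : ℂ)‖ = s * ‖(z : ℂ)‖ := by
  simp [ray, projIcc_of_mem zero_le_one hs, abs_of_nonneg hs.1]

theorem one_sub_mul_norm_pos (t : Ico (0 : ℝ) 1) (z : Metric.ball (0 : ℂ) 1) :
    0 < 1 - t * ‖(z : ℂ)‖ := by
  have hz := norm_lt_one z
  nlinarith [t.2.1, t.2.2, norm_nonneg (z : ℂ)]

/-- The value at `x` of the eigenfunction `z ^ j / (1 - t z) ^ (j + 1)` of `C_t`. -/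
noncomputable def eigenWeight (t : ℝ) (j : ℕ) (x : ℝ) : ℝ :=
  (x / (1 - t * x)) ^ j / (1 - t * x)

/-- Taking absolute values under the integral along the ray replaces `1 - t ξ` by `1 - t |ξ|`, and
the remaining real integral is the eigenvalue equation for the weight. The bound on `f` is needed
only for `|z| ≤ r`, because the ray stays in that disc. -/
theorem norm_cesaroOp_le (t : Ico (0 : ℝ) 1) (j : ℕ) {f : HolDisc} {r M : ℝ}
    (hf : ∀ z : Metric.ball (0 : ℂ) 1, ‖(z : ℂ)‖ ≤ r → ‖f z‖ ≤ M * eigenWeight t j ‖(z : ℂ)‖)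
    (z : Metric.ball (0 : ℂ) 1) (hz : ‖(z : ℂ)‖ ≤ r) :
    ‖cesaroOp t f z‖ ≤ M / (j + 1) * eigenWeight t j ‖(z : ℂ)‖ := by
  set ρ := ‖(z : ℂ)‖ with hρ
  have hρ0 : 0 ≤ ρ := norm_nonneg _
  have hpos : ∀ s ∈ Icc (0 : ℝ) 1, 0 < 1 - t * (s * ρ) := fun s hs => by
    rw [hρ, ← norm_ray hs]
    exact one_sub_mul_norm_pos t _
  -- Explicit primitive of the majorant: `s / (1 - t s ρ)` has derivative `1 / (1 - t s ρ) ^ 2`.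
  have hder : ∀ s ∈ uIcc (0 : ℝ) 1,
      HasDerivAt (fun s : ℝ => M * ρ ^ j / (j + 1) * (s / (1 - t * (s * ρ))) ^ (j + 1))
        (M * eigenWeight t j (s * ρ) / (1 - t * (s * ρ))) s := by
    intro s hs
    rw [uIcc_of_le zero_le_one] at hs
    have hne := (hpos s hs).ne'
    have hd : HasDerivAt (fun s : ℝ => 1 - t * (s * ρ)) (-(t * ρ)) s := by
      simpa using (((hasDerivAt_id s).mul_const ρ).const_mul (t : ℝ)).const_sub 1
    refine ((((hasDerivAt_id s).div hd hne).pow (j + 1)).const_mul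
      (M * ρ ^ j / (j + 1))).congr_deriv ?_
    have hj : (j : ℝ) + 1 ≠ 0 := by positivity
    simp only [eigenWeight, id, Nat.add_sub_cancel, Nat.cast_add, Nat.cast_one, Pi.div_apply,
      div_pow, mul_pow]
    field_simp
    ring
  have hcont : ContinuousOn (fun s : ℝ => M * eigenWeight t j (s * ρ) / (1 - t * (s * ρ)))
      (uIcc (0 : ℝ) 1) := by
    rw [uIcc_of_le zero_le_one]
    unfold eigenWeight
    have hne : ∀ s ∈ Icc (0 : ℝ) 1, 1 - t * (s * ρ) ≠ 0 := fun s hs => (hpos s hs).ne'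
    have h1 : ContinuousOn (fun s : ℝ => s * ρ) (Icc 0 1) := by fun_prop
    have h2 : ContinuousOn (fun s : ℝ => 1 - t * (s * ρ)) (Icc 0 1) := by fun_prop
    exact (continuousOn_const.mul (((h1.div h2 hne).pow j).div h2 hne)).div h2 hne
  have hint := intervalIntegral.integral_eq_sub_of_hasDerivAt hder hcont.intervalIntegrable
  rw [coe_cesaroOp, cesaroFun_eq_ray]
  refine (intervalIntegral.norm_integral_le_of_norm_le zero_le_one
    (Eventually.of_forall fun s hs => ?_) hcont.intervalIntegrable).trans (hint.trans ?_).le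
  · have hs' : s ∈ Icc (0 : ℝ) 1 := ⟨hs.1.le, hs.2⟩
    rw [norm_div]
    have hn := norm_ray hs' z
    have hle : ‖f (ray s z)‖ ≤ M * eigenWeight t j (s * ρ) := by
      rw [hρ, ← hn]
      exact hf _ (hn.le.trans ((mul_le_of_le_one_left hρ0 hs'.2).trans hz))
    have hden : 1 - t * (s * ρ) ≤ ‖1 - (t : ℂ) * (ray s z : ℂ)‖ := by
      refine le_trans (le_of_eq ?_) (norm_sub_norm_le _ _)
      rw [norm_mul, hn, norm_one, Complex.norm_real, Real.norm_of_nonneg t.2.1]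
    exact div_le_div₀ ((norm_nonneg _).trans hle) hle (hpos s hs') hden
  · have hne := (hpos 1 (by simp)).ne'
    rw [one_mul] at hne
    have hj : (j : ℝ) + 1 ≠ 0 := by positivity
    simp only [eigenWeight, one_mul, zero_div, ne_eq, Nat.succ_ne_zero, not_false_eq_true, zero_pow,
      mul_zero, sub_zero, div_pow]
    field_simp
    ring

theorem norm_cesaroOp_pow_le (t : Ico (0 : ℝ) 1) (j : ℕ) {f : HolDisc} {r M : ℝ}
    (hf : ∀ z : Metric.ball (0 : ℂ) 1, ‖(z : ℂ)‖ ≤ r → ‖f z‖ ≤ M * eigenWeight t j ‖(z : ℂ)‖)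
    (n : ℕ) (z : Metric.ball (0 : ℂ) 1) (hz : ‖(z : ℂ)‖ ≤ r) :
    ‖(cesaroOp t ^ n) f z‖ ≤ M / (j + 1) ^ n * eigenWeight t j ‖(z : ℂ)‖ := by
  induction n generalizing z with
  | zero => simpa using hf z hz
  | succ n ih =>
    rw [pow_succ', pow_succ, ← div_div]
    exact norm_cesaroOp_le t j ih z hz

theorem one_le_eigenWeight_zero (t : Ico (0 : ℝ) 1) (z : Metric.ball (0 : ℂ) 1) :
    1 ≤ eigenWeight t 0 ‖(z : ℂ)‖ := by
  rw [eigenWeight, pow_zero, le_div_iff₀ (one_sub_mul_norm_pos t z)]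
  nlinarith [mul_nonneg t.2.1 (norm_nonneg (z : ℂ))]

theorem one_sub_le_one_sub_mul_norm (t : Ico (0 : ℝ) 1) (z : Metric.ball (0 : ℂ) 1) :
    1 - (t : ℝ) ≤ 1 - t * ‖(z : ℂ)‖ := by
  have hz := norm_lt_one z
  nlinarith [t.2.1]

theorem eigenWeight_zero_le (t : Ico (0 : ℝ) 1) (z : Metric.ball (0 : ℂ) 1) :
    eigenWeight t 0 ‖(z : ℂ)‖ ≤ (1 - (t : ℝ))⁻¹ := by
  rw [eigenWeight, pow_zero, one_div]
  exact inv_anti₀ (sub_pos.2 t.2.2) (one_sub_le_one_sub_mul_norm t z)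

theorem norm_le_eigenWeight_one (t : Ico (0 : ℝ) 1) (z : Metric.ball (0 : ℂ) 1) :
    ‖(z : ℂ)‖ ≤ eigenWeight t 1 ‖(z : ℂ)‖ := by
  have hp := one_sub_mul_norm_pos t z
  have h1 : 1 - t * ‖(z : ℂ)‖ ≤ 1 := by linarith [mul_nonneg t.2.1 (norm_nonneg (z : ℂ))]
  rw [eigenWeight, pow_one, le_div_iff₀ hp, le_div_iff₀ hp, mul_assoc]
  exact mul_le_of_le_one_right (norm_nonneg _) (mul_le_one₀ h1 hp.le h1)

theorem eigenWeight_one_le (t : Ico (0 : ℝ) 1) (z : Metric.ball (0 : ℂ) 1) :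
    eigenWeight t 1 ‖(z : ℂ)‖ ≤ ((1 - (t : ℝ)) ^ 2)⁻¹ := by
  have hz := norm_lt_one z
  have ht : 0 < 1 - (t : ℝ) := sub_pos.2 t.2.2
  rw [eigenWeight, pow_one, div_div, ← sq, inv_eq_one_div]
  exact div_le_div₀ zero_le_one hz.le (by positivity)
    (pow_le_pow_left₀ ht.le (one_sub_le_one_sub_mul_norm t z) 2)

/-- The iterates of `C_t` are uniformly bounded for the supremum on each disc. -/
theorem norm_cesaroOp_pow_le_of_norm_le (t : Ico (0 : ℝ) 1) {f : HolDisc} {r M : ℝ} (hM : 0 ≤ M)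
    (hf : ∀ z : Metric.ball (0 : ℂ) 1, ‖(z : ℂ)‖ ≤ r → ‖f z‖ ≤ M)
    (n : ℕ) (z : Metric.ball (0 : ℂ) 1) (hz : ‖(z : ℂ)‖ ≤ r) :
    ‖(cesaroOp t ^ n) f z‖ ≤ M * (1 - (t : ℝ))⁻¹ := by
  -- The weight for `j = 0` lies between `1` and `(1 - t)⁻¹`: the lower bound brings it in, the
  -- upper one removes it.
  refine (norm_cesaroOp_pow_le t 0 (M := M) (r := r) (fun w hw => (hf w hw).trans
    (le_mul_of_one_le_right hM (one_le_eigenWeight_zero t w))) n z hz).trans ?_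
  simpa using mul_le_mul_of_nonneg_left (eigenWeight_zero_le t z) hM

/-- The iterates of `C_t` on the functions that vanish at `0` decay geometrically. -/
theorem norm_cesaroOp_pow_le_of_center_eq_zero (t : Ico (0 : ℝ) 1) {f : HolDisc}
    (h0 : f center = 0) {r R M : ℝ} (hR : R ∈ Ioo (0 : ℝ) 1) (hrR : r < R) (hM : 0 ≤ M)
    (hf : ∀ z : Metric.ball (0 : ℂ) 1, ‖(z : ℂ)‖ ≤ R → ‖f z‖ ≤ M)
    (n : ℕ) (z : Metric.ball (0 : ℂ) 1) (hz : ‖(z : ℂ)‖ ≤ r) :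
    ‖(cesaroOp t ^ n) f z‖ ≤ M * (R⁻¹ * ((1 - (t : ℝ)) ^ 2)⁻¹) * (1 / 2) ^ n := by
  have hMR : 0 ≤ M / R := div_nonneg hM hR.1.le
  refine (norm_cesaroOp_pow_le t 1 (M := M / R) (r := r) (fun w hw =>
    (norm_le_mul_norm_of_center_eq_zero h0 hR hf (hw.trans_lt hrR)).trans
    (mul_le_mul_of_nonneg_left (norm_le_eigenWeight_one t w) hMR)) n z hz).trans ?_
  refine (mul_le_mul_of_nonneg_left (eigenWeight_one_le t z) (by positivity)).trans (le_of_eq ?_)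
  rw [Nat.cast_one, one_add_one_eq_two, one_div, inv_pow]
  ring

/-! ### The fixed function and the range of `I - C_t` -/

/-- Fundamental theorem of calculus along the segment: `C_t f = K` amounts to `(z K)' = f / (1 - t
z)`. The value `K 0` must be prescribed separately, since `z K` does not see it. -/
theorem cesaroFun_eq_of_hasDerivAt {t : ℝ} (ht : t ∈ Ico (0 : ℝ) 1) {f : HolDisc} {K : ℂ → ℂ}
    (hK : ∀ z ∈ Metric.ball (0 : ℂ) 1,
      HasDerivAt (fun w => w * K w) (f.extendZero z / (1 - t * z)) z)
    (h0 : K 0 = f center) {z : ℂ} (hz : z ∈ Metric.ball (0 : ℂ) 1) : cesaroFun t f z = K z := by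
  rcases eq_or_ne z 0 with rfl | hne
  · rw [cesaroFun, if_pos rfl, h0]
    exact extendZero_of_mem f hz
  have hd : ∀ s ∈ uIcc (0 : ℝ) 1, HasDerivAt (fun s : ℝ => (s * z : ℂ) * K (s * z))
      (f.extendZero (s * z) / (1 - t * (s * z)) * z) s := by
    intro s hs
    rw [uIcc_of_le zero_le_one] at hs
    have h1 : HasDerivAt (fun s : ℝ => (s : ℂ) * z) z s := by
      simpa using (Complex.ofRealCLM.hasDerivAt (x := s)).mul_const z
    exact (hK _ (mul_mem_ball hs hz)).comp s h1
  have hc : ContinuousOn (fun s : ℝ => f.extendZero (s * z) / (1 - t * (s * z)) * z)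
      (uIcc (0 : ℝ) 1) := by
    rw [uIcc_of_le zero_le_one]
    exact ((differentiableOn_integrand ht f).continuousOn.comp
      (f := fun s : ℝ => (s : ℂ) * z) (s := Icc (0 : ℝ) 1) (by fun_prop)
      fun s hs => mul_mem_ball hs hz).mul continuousOn_const
  have hint := intervalIntegral.integral_eq_sub_of_hasDerivAt hd hc.intervalIntegrable
  rw [cesaroFun, if_neg hne, segmentIntegral, hint]
  simp [hne]

theorem cesaroOp_apply_center (t : Ico (0 : ℝ) 1) (f : HolDisc) :
    cesaroOp t f center = f center := by
  rw [coe_cesaroOp, cesaroFun, if_pos (show (center : ℂ) = 0 from rfl)]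
  exact extendZero_of_mem f center.2

theorem hasDerivAt_one_sub_mul (t z : ℂ) : HasDerivAt (fun w : ℂ => 1 - t * w) (-t) z := by
  simpa using ((hasDerivAt_id z).const_mul t).const_sub 1

/-- The function `1 / (1 - t z)`, which is fixed by `C_t`. -/
noncomputable def fixedFun (t : Ico (0 : ℝ) 1) : HolDisc :=
  ofFun (fun z => 1 / (1 - (t : ℂ) * z))
    ((differentiableOn_const 1).div (by fun_prop) fun _ hz => one_sub_ne_zero t.2 hz)

theorem fixedFun_center (t : Ico (0 : ℝ) 1) : fixedFun t center = 1 := by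
  rw [fixedFun, ofFun_apply]
  simp [center]

theorem cesaroOp_fixedFun (t : Ico (0 : ℝ) 1) : cesaroOp t (fixedFun t) = fixedFun t := by
  refine ext' fun z => cesaroFun_eq_of_hasDerivAt (K := fun z => 1 / (1 - (t : ℂ) * z)) t.2
    (fun w hw => ?_) ?_ z.2
  · have hne := one_sub_ne_zero t.2 hw
    refine ((hasDerivAt_id w).mul
      ((hasDerivAt_const w (1 : ℂ)).div (hasDerivAt_one_sub_mul t w) hne)).congr_deriv ?_
    rw [extendZero_of_mem _ hw, fixedFun, ofFun_apply]
    simp only [id, Pi.div_apply]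
    field_simp
    ring
  · rw [fixedFun_center]
    simp

/-- With `f = g + k` the equation becomes `C_t (g + k) = k`, that is `(z k)' = (g + k) / (1 - t z)`,
which simplifies to `((1 - t z) k)' = g / z`. The right side is holomorphic because `g(0) = 0`. -/
theorem exists_sub_cesaroOp_eq (t : Ico (0 : ℝ) 1) {g : HolDisc} (hg : g center = 0) :
    ∃ f, f - cesaroOp t f = g := by
  have hg0 : g.extendZero 0 = 0 := (g.extendZero_of_mem center.2).trans hg
  have hD : DifferentiableOn ℂ (dslope g.extendZero 0) (Metric.ball 0 1) :=
    (Complex.differentiableOn_dslope (Metric.ball_mem_nhds _ one_pos)).2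
      g.differentiableOn_extendZero
  -- `V` is a primitive of `g(z) / z`; subtracting `V 0` makes `k(0) = 0`.
  obtain ⟨V, hV⟩ := hD.isExactOn_ball
  have hKd : ∀ z ∈ Metric.ball (0 : ℂ) 1, HasDerivAt (fun w => (V w - V 0) / (1 - (t : ℂ) * w))
      ((dslope g.extendZero 0 z * (1 - t * z) - (V z - V 0) * -t) / (1 - t * z) ^ 2) z :=
    fun z hz => ((hV z hz).sub_const _).div (hasDerivAt_one_sub_mul t z) (one_sub_ne_zero t.2 hz)
  let k := ofFun (fun w => (V w - V 0) / (1 - (t : ℂ) * w))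
    fun z hz => (hKd z hz).differentiableAt.differentiableWithinAt
  have hk : cesaroOp t (g + k) = k := by
    refine ext' fun z => cesaroFun_eq_of_hasDerivAt
      (K := fun w => (V w - V 0) / (1 - (t : ℂ) * w)) t.2 (fun w hw => ?_) ?_ z.2
    · have hne := one_sub_ne_zero t.2 hw
      have hs : w * dslope g.extendZero 0 w = g.extendZero w := by
        simpa [hg0] using sub_smul_dslope g.extendZero 0 w
      refine ((hasDerivAt_id w).mul (hKd w hw)).congr_deriv ?_
      rw [extendZero_of_mem _ hw, add_apply, ← extendZero_of_mem g hw, ← hs]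
      change _ = (_ + (V w - V 0) / (1 - (t : ℂ) * w)) / _
      simp only [id]
      field_simp
      ring
    · rw [add_apply, hg, zero_add]
      rfl
  exact ⟨g + k, by rw [hk, add_sub_cancel_right]⟩

theorem range_sub_cesaroOp (t : Ico (0 : ℝ) 1) :
    (range fun f : HolDisc => f - cesaroOp t f) = {g : HolDisc | g center = 0} := by
  ext g
  constructor
  · rintro ⟨f, rfl⟩
    change f center - cesaroOp t f center = 0
    rw [cesaroOp_apply_center, sub_self]
  · exact exists_sub_cesaroOp_eq t

/-! ### The projection onto the fixed space -/

/-- The projection `f ↦ f(0) / (1 - t z)` onto the fixed space of `C_t`. -/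
noncomputable def fixedProj (t : Ico (0 : ℝ) 1) : HolDisc →L[ℂ] HolDisc :=
  (evalCLM center).smulRight (fixedFun t)

theorem fixedProj_apply (t : Ico (0 : ℝ) 1) (f : HolDisc) :
    fixedProj t f = f center • fixedFun t := rfl

theorem fixedProj_apply_center (t : Ico (0 : ℝ) 1) (f : HolDisc) :
    fixedProj t f center = f center := by
  rw [fixedProj_apply, smul_apply, fixedFun_center, mul_one]

theorem sub_fixedProj_apply_center (t : Ico (0 : ℝ) 1) (f : HolDisc) :
    (f - fixedProj t f) center = 0 := by
  rw [sub_apply, fixedProj_apply_center, sub_self]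

theorem cesaroOp_fixedProj (t : Ico (0 : ℝ) 1) (f : HolDisc) :
    cesaroOp t (fixedProj t f) = fixedProj t f := by
  rw [fixedProj_apply, map_smul, cesaroOp_fixedFun]

theorem pow_apply_eq_self {T : HolDisc →L[ℂ] HolDisc} {f : HolDisc} (h : T f = f) (n : ℕ) :
    (T ^ n) f = f := by
  induction n with
  | zero => rfl
  | succ n ih =>
    rw [pow_succ]
    exact (congrArg (T ^ n) h).trans ih

theorem cesaroOp_pow_sub_fixedProj (t : Ico (0 : ℝ) 1) (f : HolDisc) (n : ℕ) :
    (cesaroOp t ^ n) (f - fixedProj t f) = (cesaroOp t ^ n) f - fixedProj t f := by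
  rw [map_sub, pow_apply_eq_self (cesaroOp_fixedProj t f)]

/-- Such an `f` equals all its iterates, and these tend to `0`. -/
theorem eq_zero_of_cesaroOp_eq_self (t : Ico (0 : ℝ) 1) {f : HolDisc} (hf : cesaroOp t f = f)
    (h0 : f center = 0) : f = 0 := by
  refine ext' fun z => ?_
  have hz := norm_lt_one z
  have hR : (‖(z : ℂ)‖ + 1) / 2 ∈ Ioo (0 : ℝ) 1 := ⟨by positivity, by linarith⟩
  obtain ⟨M, hM⟩ := f.exists_norm_le hR.2
  have hM0 : 0 ≤ M := (norm_nonneg _).trans (hM z (by linarith))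
  have hlim : Tendsto (fun n : ℕ => M * (((‖(z : ℂ)‖ + 1) / 2)⁻¹ * ((1 - (t : ℝ)) ^ 2)⁻¹) *
      (1 / 2) ^ n) atTop (𝓝 0) := by
    simpa using (tendsto_pow_atTop_nhds_zero_of_lt_one (r := (1 / 2 : ℝ)) (by norm_num)
      (by norm_num)).const_mul (M * (((‖(z : ℂ)‖ + 1) / 2)⁻¹ * ((1 - (t : ℝ)) ^ 2)⁻¹))
  have hle : ‖f z‖ ≤ 0 := ge_of_tendsto' hlim fun n => by
    have := norm_cesaroOp_pow_le_of_center_eq_zero t h0 (r := ‖(z : ℂ)‖) hR (by linarith) hM0 hM n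
      z le_rfl
    rwa [pow_apply_eq_self hf] at this
  exact norm_le_zero_iff.1 hle

/-- The kernel and range of `I - C_t` are the range and kernel of the continuous idempotent
`fixedProj t`. -/
theorem isTopCompl_ker_range (t : Ico (0 : ℝ) 1) :
    Submodule.IsTopCompl (ContinuousLinearMap.id ℂ HolDisc - cesaroOp t).ker
      (ContinuousLinearMap.id ℂ HolDisc - cesaroOp t).range := by
  have hP : IsIdempotentElem (fixedProj t) := by
    refine ContinuousLinearMap.ext fun f => ?_
    change fixedProj t (fixedProj t f) = fixedProj t f
    rw [fixedProj_apply, fixedProj_apply_center, ← fixedProj_apply]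
  convert ContinuousLinearMap.IsIdempotentElem.isTopCompl hP using 1
  · ext f
    simp only [LinearMap.mem_ker, LinearMap.mem_range, ContinuousLinearMap.coe_coe]
    constructor
    · intro hf
      have hf' : cesaroOp t f = f := (sub_eq_zero.1 hf).symm
      refine ⟨f, (sub_eq_zero.1 (eq_zero_of_cesaroOp_eq_self t ?_
        (sub_fixedProj_apply_center t f))).symm⟩
      rw [map_sub, cesaroOp_fixedProj, hf']
    · rintro ⟨g, rfl⟩
      exact sub_eq_zero.2 (cesaroOp_fixedProj t g).symm
  · ext g
    have h := Set.ext_iff.1 (range_sub_cesaroOp t) g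
    simp only [LinearMap.mem_ker, LinearMap.mem_range, ContinuousLinearMap.coe_coe]
    refine h.trans ⟨fun hg => ?_, fun hg => ?_⟩
    · rw [fixedProj_apply, show g center = 0 from hg, zero_smul]
    · change g center = 0
      rw [← fixedProj_apply_center t g, hg, zero_apply]

/-! ### Dynamics -/

theorem isPowerBoundedOp_cesaroOp (t : Ico (0 : ℝ) 1) : IsPowerBoundedOp (cesaroOp t) := by
  refine equicontinuous_of_equicontinuousAt_zero (fun n : ℕ => cesaroOp t ^ n) ?_
  have ht : 0 < 1 - (t : ℝ) := sub_pos.2 t.2.2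
  rw [EquicontinuousAt]
  intro U hU
  have hU' : {f : HolDisc | ((0 : HolDisc), f) ∈ U} ∈ 𝓝 (0 : HolDisc) := mem_nhds_left 0 hU
  obtain ⟨⟨r, ε⟩, ⟨hr, hε⟩, hsub⟩ := hasBasis_nhds_zero.mem_iff.1 hU'
  -- The factor `1 - t` cancels the bound on the iterates; halving `ε` restores a strict inequality.
  have hδ : 0 < ε / 2 * (1 - (t : ℝ)) := by positivity
  filter_upwards [hasBasis_nhds_zero.mem_of_mem (i := (r, ε / 2 * (1 - (t : ℝ)))) ⟨hr, hδ⟩]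
    with f hf n
  change ((cesaroOp t ^ n) 0, (cesaroOp t ^ n) f) ∈ U
  rw [map_zero]
  refine hsub fun z hz => ?_
  have := norm_cesaroOp_pow_le_of_norm_le t hδ.le (fun z hz => (hf z hz).le) n z hz
  rw [mul_assoc, mul_inv_cancel₀ ht.ne', mul_one] at this
  linarith

theorem cesaroMean_sub_fixedProj_apply (t : Ico (0 : ℝ) 1) {n : ℕ} (hn : n ≠ 0) (f : HolDisc)
    (z : Metric.ball (0 : ℂ) 1) :
    (cesaroMean (cesaroOp t) n - fixedProj t) f z =
      (n : ℂ)⁻¹ * ∑ m ∈ Finset.Icc 1 n, (cesaroOp t ^ m) (f - fixedProj t f) z := by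
  have hn' : (n : ℂ) ≠ 0 := Nat.cast_ne_zero.2 hn
  have hsum : (∑ m ∈ Finset.Icc 1 n, cesaroOp t ^ m) f z =
      ∑ m ∈ Finset.Icc 1 n, (cesaroOp t ^ m) f z := by
    rw [_root_.sum_apply]
    exact map_sum (evalCLM z) _ _
  change (n : ℂ)⁻¹ * (∑ m ∈ Finset.Icc 1 n, cesaroOp t ^ m) f z - fixedProj t f z = _
  simp only [cesaroOp_pow_sub_fixedProj, sub_apply, hsum, Finset.sum_sub_distrib,
    Finset.sum_const, Nat.card_Icc, Nat.add_sub_cancel, nsmul_eq_mul]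
  field_simp

theorem isUniformlyMeanErgodic_cesaroOp (t : Ico (0 : ℝ) 1) :
    IsUniformlyMeanErgodic (cesaroOp t) := by
  refine ⟨fixedProj t, tendsto_sub_nhds_zero_iff.1 ?_⟩
  refine (ContinuousLinearMap.hasBasis_nhds_zero_of_basis hasBasis_nhds_zero).tendsto_right_iff.2 ?_
  rintro ⟨S, r, ε⟩ ⟨hS, hr, hε⟩
  have hR : (r + 1) / 2 ∈ Ioo (0 : ℝ) 1 := ⟨by linarith [hr.1], by linarith [hr.2]⟩
  have hrR : r < (r + 1) / 2 := by linarith [hr.2]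
  -- The image of `S` under `I - P` is still bounded and consists of functions vanishing at `0`; one
  -- `M` serves all of `S`. Below, `|M|` covers an empty `S`, where `M` could be negative.
  obtain ⟨M, hM⟩ := exists_norm_le_of_isVonNBounded
    (hS.image (ContinuousLinearMap.id ℂ HolDisc - fixedProj t)) hR
  set A : ℝ := |M| * (((r + 1) / 2)⁻¹ * ((1 - (t : ℝ)) ^ 2)⁻¹) with hA
  have hA0 : 0 ≤ A := mul_nonneg (abs_nonneg M)
    (mul_nonneg (inv_nonneg.2 hR.1.le) (inv_nonneg.2 (sq_nonneg _)))
  have hlim : Tendsto (fun n : ℕ => A * 2 / (n : ℝ)) atTop (𝓝 0) :=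
    tendsto_const_div_atTop_nhds_zero_nat _
  filter_upwards [hlim.eventually_lt_const hε, eventually_ne_atTop 0] with n hn hn0 f hf z hz
  rw [cesaroMean_sub_fixedProj_apply t hn0, norm_mul, norm_inv, RCLike.norm_natCast]
  refine lt_of_le_of_lt ?_ hn
  rw [div_eq_inv_mul]
  refine mul_le_mul_of_nonneg_left ?_ (by positivity)
  -- The geometric series bounds the sums independently of `n`, so the means converge at rate `1 /
  -- n`.
  calc ‖∑ m ∈ Finset.Icc 1 n, (cesaroOp t ^ m) (f - fixedProj t f) z‖
      ≤ ∑ m ∈ Finset.Icc 1 n, A * (1 / 2 : ℝ) ^ m := norm_sum_le_of_le _ fun m _ =>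
        norm_cesaroOp_pow_le_of_center_eq_zero t (sub_fixedProj_apply_center t f) hR hrR
          (abs_nonneg M) (fun w hw => (hM _ ⟨f, hf, rfl⟩ w hw).trans (le_abs_self M)) m z hz
    _ ≤ A * 2 := by
        rw [← Finset.mul_sum]
        refine mul_le_mul_of_nonneg_left ?_ hA0
        exact (summable_geometric_two.sum_le_tsum _ fun _ _ => by positivity).trans
          tsum_geometric_two.le

/-- If `f(0) = 0`, the projective orbit stays in the closed hyperplane of functions vanishing at
`0`. Otherwise every `y` in it satisfies `|y(1/2)| ≤ const * |y(0)|`, a closed condition which the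
function `z` violates. -/
theorem not_isSupercyclicOp_cesaroOp (t : Ico (0 : ℝ) 1) : ¬ IsSupercyclicOp (cesaroOp t) := by
  rintro ⟨f, hf⟩
  have hcenter : ∀ n, (cesaroOp t ^ n) f center = f center := by
    intro n
    induction n with
    | zero => rfl
    | succ n ih =>
      rw [pow_succ']
      exact (cesaroOp_apply_center t _).trans ih
  by_cases h0 : f center = 0
  · obtain ⟨_, ⟨c, n, rfl⟩, hy⟩ := hf.exists_mem_open
      (isOpen_ne.preimage (evalCLM center).continuous : IsOpen {y | evalCLM center y ≠ 0})
      ⟨fixedFun t, by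
        change fixedFun t center ≠ 0
        rw [fixedFun_center]
        exact one_ne_zero⟩
    refine hy ?_
    rw [evalCLM_apply, smul_apply, hcenter, h0, mul_zero]
  · let w : Metric.ball (0 : ℂ) 1 := ⟨1 / 2, by rw [mem_ball_zero_iff]; norm_num⟩
    have hw : ‖(w : ℂ)‖ ≤ 1 / 2 := by simp [w]
    obtain ⟨M, hM⟩ := f.exists_norm_le (r := 1 / 2) (by norm_num)
    have hM0 : 0 ≤ M := (norm_nonneg _).trans (hM w hw)
    have hopen : IsOpen {y : HolDisc |
        M * (1 - (t : ℝ))⁻¹ * ‖evalCLM center y‖ < ‖f center‖ * ‖evalCLM w y‖} :=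
      isOpen_lt (continuous_const.mul (evalCLM center).continuous.norm)
        (continuous_const.mul (evalCLM w).continuous.norm)
    obtain ⟨_, ⟨c, n, rfl⟩, hy⟩ := hf.exists_mem_open hopen ⟨ofFun id differentiableOn_id, by
      change M * (1 - (t : ℝ))⁻¹ * ‖(0 : ℂ)‖ < ‖f center‖ * ‖(1 / 2 : ℂ)‖
      rw [norm_zero, mul_zero]
      exact mul_pos (norm_pos_iff.2 h0) (by norm_num)⟩
    have hb := norm_cesaroOp_pow_le_of_norm_le t hM0 hM n w hw
    refine (not_le_of_gt (mem_ofPred_eq ▸ hy)) ?_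
    rw [evalCLM_apply, evalCLM_apply, smul_apply, smul_apply, hcenter, norm_mul, norm_mul]
    calc ‖f center‖ * (‖c‖ * ‖(cesaroOp t ^ n) f w‖)
        ≤ ‖f center‖ * (‖c‖ * (M * (1 - (t : ℝ))⁻¹)) := by gcongr
      _ = M * (1 - (t : ℝ))⁻¹ * (‖c‖ * ‖f center‖) := by ring

end HolDisc

theorem mainTheorem5 (t : Set.Ico (0 : ℝ) 1) :
    IsPowerBoundedOp (cesaroOp t) ∧
    IsUniformlyMeanErgodic (cesaroOp t) ∧
    ¬ IsSupercyclicOp (cesaroOp t) ∧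
    IsClosed (Set.range fun f : HolDisc => f - cesaroOp t f) ∧
    (Set.range fun f : HolDisc => f - cesaroOp t f) =
      {g : HolDisc | g HolDisc.center = 0} ∧
    Submodule.IsTopCompl
      (ContinuousLinearMap.id ℂ HolDisc - cesaroOp t).ker
      (ContinuousLinearMap.id ℂ HolDisc - cesaroOp t).range := by
  refine ⟨HolDisc.isPowerBoundedOp_cesaroOp t, HolDisc.isUniformlyMeanErgodic_cesaroOp t,
    HolDisc.not_isSupercyclicOp_cesaroOp t, ?_, HolDisc.range_sub_cesaroOp t,
    HolDisc.isTopCompl_ker_range t⟩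
  rw [HolDisc.range_sub_cesaroOp]
  exact isClosed_singleton.preimage (HolDisc.evalCLM HolDisc.center).continuous
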